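/- Let $d_v\ge 3$ be an integer, let $\rho_2,\dots,\rho_{d_r}\ge 0$ with $\sum_{j=2}^{d_r}\rho_j=1$ ($\rho_j$ is the fraction of edges of the Tanner graph that meet a check node of degree $j$), and let $R\in(0,1]$ be the code rate. Put $$\phi(x)=1-\frac{1}{\sqrt{4\pi x}}\int_{\mathbb R}\tanh\frac u2\; e^{-(u-x)^2/(4x)}\,du\quad(x>0),\qquad \phi(0)=1,$$ a decreasing bijection from $[0,\infty)$ onto $(0,1]$. For $E_b/N_0>0$ (on the linear scale) let $m_\lambda=4RE_b/N_0$ be the mean of the channel LLR. The check node output means in the consistent Gaussian approximation to density evolution of the log-domain sum-product decoder of $(d_v,\rho)$ variable-regular, check-irregular LDPC codes on the binary-input AWGN channel are given by $m^{(0)}=0$ and $$m^{(l)}=\sum_{j=2}^{d_r}\rho_j\,\phi^{-1}\!\left(1-\bigl[1-\phi\bigl(m_\lambda+(d_v-1)m^{(l-1)}\bigr)\bigr]^{j-1}\right)\qquad(l\ge 1).$$ The decoding threshold is the infimum of the values $E_b/N_0>0$ for which the bit error probability $P^{(l)}=\Pr[Z_l\le 0]$, with $Z_l\sim N(\mu_l,2\mu_l)$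 and $\mu_l=m_\lambda+d_v m^{(l)}$, tends to $0$ as $l\to\infty$. Then at every $E_b/N_0$ above the decoding threshold, for every real $r$ with $1\le r<d_v-1$ and every constant $C$, there is an $L$ such that $m^{(l)}>C\,r^l$ for all $l\ge L$. -/

import Mathlib

open Filter Topology

namespace DensityEvolution

noncomputable section

/-- The function `φ` of the Gaussian approximation to density evolution:
`φ x = 1 - E[tanh (U / 2)]` with `U ~ N(x, 2 x)` when `0 < x`, and `φ 0 = 1`.
(Only arguments `0 ≤ x` matter; the value on negative reals is a convention.) -/
def phi (x : ℝ) : ℝ :=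
  if 0 < x then
    1 - 1 / Real.sqrt (4 * Real.pi * x) *
      ∫ u : ℝ, Real.tanh (u / 2) * Real.exp (-(u - x) ^ 2 / (4 * x))
  else 1

/-- The inverse of `φ`, regarded as a function on `[0, ∞)`. -/
def phiInv : ℝ → ℝ := Function.invFunOn phi (Set.Ici 0)

/-- Output mean of a check node of degree `j` whose incoming messages have mean `x`. -/
def checkOut (j : ℕ) (x : ℝ) : ℝ := phiInv (1 - (1 - phi x) ^ (j - 1))

/-- The check node output mean `m_{λ(ex)}^{(l)}` after `l` iterations, for variable degree `dv`,
check degree distribution `ρ` (the fraction of edges at check nodes of degree `j` is `ρ j`,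
`2 ≤ j ≤ dr`) and channel LLR mean `mch`.  Before the first iteration there is no check node
message, so that the first variable node messages are the channel LLRs. -/
def checkMean (dv dr : ℕ) (ρ : ℕ → ℝ) (mch : ℝ) : ℕ → ℝ
  | 0 => 0
  | l + 1 => ∑ j ∈ Finset.Icc 2 dr,
      ρ j * checkOut j (mch + ((dv : ℝ) - 1) * checkMean dv dr ρ mch l)

/-- Mean of the channel LLR for code rate `R` and `snr = E_b / N_0` (linear scale, not dB). -/
def channelMean (R snr : ℝ) : ℝ := 4 * R * snr

/-- Mean of the decision statistic of a bit after `l` iterations: the channel LLR plus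
the messages of all `dv` neighbouring check nodes. -/
def decisionMean (dv dr : ℕ) (ρ : ℕ → ℝ) (mch : ℝ) (l : ℕ) : ℝ :=
  mch + (dv : ℝ) * checkMean dv dr ρ mch l

/-- Bit error probability after `l` iterations, given that `+1` was sent: the probability that
the decision statistic, a consistent Gaussian `N(μ, 2 μ)`, is not positive. -/
def bitErrorProb (dv dr : ℕ) (ρ : ℕ → ℝ) (mch : ℝ) (l : ℕ) : ℝ :=
  (ProbabilityTheory.gaussianReal (decisionMean dv dr ρ mch l)
    (2 * decisionMean dv dr ρ mch l).toNNReal).real (Set.Iic 0)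

/-- The decoding threshold in terms of `E_b / N_0`: the infimum of the values `e > 0` at which
the bit error probability of density evolution tends to `0`
(in the extended reals, so that it is `⊤` if there is no such value). -/
def decodingThreshold (dv dr : ℕ) (ρ : ℕ → ℝ) (R : ℝ) : EReal :=
  sInf ((fun e : ℝ => (e : EReal)) '' {e : ℝ | 0 < e ∧
    Tendsto (fun l : ℕ => bitErrorProb dv dr ρ (channelMean R e) l) atTop (𝓝 0)})

end

end DensityEvolution

/-! ### Exponential decay of `phi` -/

namespace DensityEvolution

open MeasureTheory

/-! Since `phi x = exp (-x / 4) * sechMean x` with `sechMean` decreasing, Bernoulli's inequality `1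
- (1 - phi x) ^ (j - 1) ≤ (j - 1) * phi x` shows that a check node costs at most `4 log (j - 1)`
(`sub_log_le_checkOut`). Hence `m (l + 1) ≥ (dv - 1) * m l - K` with `K = checkLoss dr ρ`, and one
value above `K / (dv - 2)` forces growth beyond every `r ^ l` with `r < dv - 1`. Such a value exists
above the threshold: vanishing error probability at some smaller SNR makes the means there
unbounded, and `checkMean_mono` carries this upwards. -/

/-- The factor of `φ x` that remains after splitting off `exp (-x / 4)`. -/
noncomputable def sechMean (x : ℝ) : ℝ :=
  1 / √Real.pi * ∫ s : ℝ, Real.exp (-s ^ 2) / Real.cosh (√x * s)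

lemma integrable_exp_neg_sq : Integrable fun s : ℝ => Real.exp (-s ^ 2) := by
  simpa using integrable_exp_neg_mul_sq (b := 1) one_pos

lemma exp_div_cosh_le (x s : ℝ) :
    Real.exp (-s ^ 2) / Real.cosh (√x * s) ≤ Real.exp (-s ^ 2) :=
  div_le_self (Real.exp_pos _).le (Real.one_le_cosh _)

lemma continuous_exp_div_cosh (x : ℝ) :
    Continuous fun s : ℝ => Real.exp (-s ^ 2) / Real.cosh (√x * s) :=
  Continuous.div (by fun_prop) (Real.continuous_cosh.comp (by fun_prop))
    fun s => (Real.cosh_pos _).ne'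

lemma norm_exp_div_cosh_le (x s : ℝ) :
    ‖Real.exp (-s ^ 2) / Real.cosh (√x * s)‖ ≤ Real.exp (-s ^ 2) := by
  rw [Real.norm_of_nonneg (div_pos (Real.exp_pos _) (Real.cosh_pos _)).le]
  exact exp_div_cosh_le x s

lemma integrable_exp_div_cosh (x : ℝ) :
    Integrable fun s : ℝ => Real.exp (-s ^ 2) / Real.cosh (√x * s) :=
  integrable_exp_neg_sq.mono' (continuous_exp_div_cosh x).aestronglyMeasurable
    (Eventually.of_forall (norm_exp_div_cosh_le x))

lemma continuous_sechMean : Continuous sechMean := by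
  refine continuous_const.mul (continuous_of_dominated
    (fun x => (continuous_exp_div_cosh x).aestronglyMeasurable)
    (fun x => Eventually.of_forall (norm_exp_div_cosh_le x)) integrable_exp_neg_sq
    (Eventually.of_forall fun s => ?_))
  exact Continuous.div continuous_const
    (Real.continuous_cosh.comp (Real.continuous_sqrt.mul continuous_const))
    fun x => (Real.cosh_pos _).ne'

lemma sechMean_antitone : Antitone sechMean := by
  intro x y hxy
  refine mul_le_mul_of_nonneg_left ?_ (by positivity)
  refine integral_mono (integrable_exp_div_cosh y) (integrable_exp_div_cosh x) fun s => ?_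
  refine div_le_div_of_nonneg_left (Real.exp_pos _).le (Real.cosh_pos _) ?_
  rw [Real.cosh_le_cosh, abs_mul, abs_mul, abs_of_nonneg (Real.sqrt_nonneg x),
    abs_of_nonneg (Real.sqrt_nonneg y)]
  exact mul_le_mul_of_nonneg_right (Real.sqrt_le_sqrt hxy) (abs_nonneg s)

lemma sechMean_zero : sechMean 0 = 1 := by
  have h := integral_gaussian 1
  simp only [neg_mul, one_mul, div_one] at h
  simp only [sechMean, Real.sqrt_zero, zero_mul, Real.cosh_zero, div_one, h]
  exact one_div_mul_cancel (Real.sqrt_pos.2 Real.pi_pos).ne'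

lemma sechMean_pos (x : ℝ) : 0 < sechMean x := by
  refine mul_pos (one_div_pos.2 (Real.sqrt_pos.2 Real.pi_pos)) ?_
  have hpos : ∀ s : ℝ, 0 < Real.exp (-s ^ 2) / Real.cosh (√x * s) :=
    fun s => div_pos (Real.exp_pos _) (Real.cosh_pos _)
  exact integral_pos_of_integrable_nonneg_nonzero (x := 0) (continuous_exp_div_cosh x)
    (integrable_exp_div_cosh x) (fun s => (hpos s).le) (hpos 0).ne'

lemma one_sub_tanh (t : ℝ) : 1 - Real.tanh t = Real.exp (-t) / Real.cosh t := by
  rw [Real.tanh_eq_sinh_div_cosh, eq_div_iff (Real.cosh_pos t).ne', sub_mul,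
    div_mul_cancel₀ _ (Real.cosh_pos t).ne', one_mul, Real.cosh_sub_sinh]

/-- Under `u = 2 * √x * s` the factor `exp (-√x * s)` from `1 - tanh` cancels the cross term of the
Gaussian exponent. -/
lemma phi_integrand_eq {x : ℝ} (hx : 0 < x) (s : ℝ) :
    (1 - Real.tanh (2 * √x * s / 2)) * Real.exp (-(2 * √x * s - x) ^ 2 / (4 * x)) =
      Real.exp (-x / 4) * (Real.exp (-s ^ 2) / Real.cosh (√x * s)) := by
  have h : 2 * √x * s / 2 = √x * s := by ring
  have hsq : √x ^ 2 = x := Real.sq_sqrt hx.le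
  have he : -(√x * s) + -(2 * √x * s - x) ^ 2 / (4 * x) = -x / 4 + -s ^ 2 := by
    field_simp
    linear_combination (-4 * s ^ 2) * hsq
  rw [h, one_sub_tanh, div_mul_eq_mul_div, ← Real.exp_add, he, Real.exp_add, mul_div_assoc]

lemma abs_tanh_le_one (t : ℝ) : |Real.tanh t| ≤ 1 :=
  abs_le.2 ⟨(Real.neg_one_lt_tanh t).le, (Real.tanh_lt_one t).le⟩

lemma continuous_tanh_half : Continuous fun u : ℝ => Real.tanh (u / 2) := by
  simp only [Real.tanh_eq_sinh_div_cosh]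
  exact Continuous.div (Real.continuous_sinh.comp (by fun_prop))
    (Real.continuous_cosh.comp (by fun_prop)) fun s => (Real.cosh_pos _).ne'

lemma phi_eq_exp_mul_sechMean {x : ℝ} (hx : 0 ≤ x) :
    phi x = Real.exp (-x / 4) * sechMean x := by
  rcases hx.eq_or_lt with rfl | hx
  · simp [phi, sechMean_zero]
  have hg : ∀ u : ℝ, Real.exp (-(u - x) ^ 2 / (4 * x)) =
      Real.exp (-(1 / (4 * x)) * (u - x) ^ 2) := fun u => by congr 1; ring
  have hint : Integrable fun u : ℝ => Real.exp (-(u - x) ^ 2 / (4 * x)) := by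
    simp only [hg]
    exact (integrable_exp_neg_mul_sq (b := 1 / (4 * x)) (by positivity)).comp_sub_right x
  have hval : ∫ u : ℝ, Real.exp (-(u - x) ^ 2 / (4 * x)) = √(4 * Real.pi * x) := by
    simp only [hg]
    rw [integral_sub_right_eq_self (fun u : ℝ => Real.exp (-(1 / (4 * x)) * u ^ 2)) x,
      integral_gaussian]
    congr 1
    field_simp
  have htint : Integrable fun u : ℝ =>
      Real.tanh (u / 2) * Real.exp (-(u - x) ^ 2 / (4 * x)) :=
    hint.bdd_mul continuous_tanh_half.aestronglyMeasurable
      (Eventually.of_forall fun u => abs_tanh_le_one _)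
  have hs : 0 < √(4 * Real.pi * x) := Real.sqrt_pos.2 (by positivity)
  have hsx : 0 < √x := Real.sqrt_pos.2 hx
  have hsub : ∫ u : ℝ, (1 - Real.tanh (u / 2)) * Real.exp (-(u - x) ^ 2 / (4 * x)) =
      2 * √x * (Real.exp (-x / 4) * ∫ s : ℝ, Real.exp (-s ^ 2) / Real.cosh (√x * s)) := by
    have h := Measure.integral_comp_mul_left
      (fun u : ℝ => (1 - Real.tanh (u / 2)) * Real.exp (-(u - x) ^ 2 / (4 * x))) (2 * √x)
    simp only [phi_integrand_eq hx] at h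
    rw [integral_const_mul, abs_of_pos (by positivity), smul_eq_mul] at h
    rw [h, mul_inv_cancel_left₀ (by positivity)]
  have hdiff : ∫ u : ℝ, (1 - Real.tanh (u / 2)) * Real.exp (-(u - x) ^ 2 / (4 * x)) =
      √(4 * Real.pi * x) -
        ∫ u : ℝ, Real.tanh (u / 2) * Real.exp (-(u - x) ^ 2 / (4 * x)) := by
    rw [← hval, ← integral_sub hint htint]
    simp only [sub_mul, one_mul]
  have hsqrt : √(4 * Real.pi * x) = 2 * √Real.pi * √x := by
    rw [Real.sqrt_mul (by positivity), Real.sqrt_mul (by norm_num)]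
    norm_num
  have hp : 0 < √Real.pi := Real.sqrt_pos.2 Real.pi_pos
  rw [phi, if_pos hx, sechMean]
  rw [hdiff, sub_eq_iff_eq_add, ← sub_eq_iff_eq_add'] at hsub
  rw [← hsub, hsqrt]
  field_simp
  ring

lemma phi_pos {x : ℝ} (hx : 0 ≤ x) : 0 < phi x := by
  rw [phi_eq_exp_mul_sechMean hx]
  exact mul_pos (Real.exp_pos _) (sechMean_pos x)

lemma phi_zero : phi 0 = 1 := by simp [phi]

/-- On `[0, ∞)` the function `φ` decays at least as fast as `exp (-x / 4)`. -/
lemma phi_le_exp_mul_phi {x y : ℝ} (hy : 0 ≤ y) (hyx : y ≤ x) :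
    phi x ≤ Real.exp (-(x - y) / 4) * phi y := by
  rw [phi_eq_exp_mul_sechMean hy, phi_eq_exp_mul_sechMean (hy.trans hyx), ← mul_assoc,
    ← Real.exp_add]
  have h : -(x - y) / 4 + -y / 4 = -x / 4 := by ring
  rw [h]
  exact mul_le_mul_of_nonneg_left (sechMean_antitone hyx) (Real.exp_pos _).le

lemma phi_strictAntiOn : StrictAntiOn phi (Set.Ici 0) := by
  intro y hy x _ hyx
  refine (phi_le_exp_mul_phi hy hyx.le).trans_lt ?_
  exact mul_lt_of_lt_one_left (phi_pos hy) (Real.exp_lt_one_iff.2 (by linarith))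

lemma phi_le_one {x : ℝ} (hx : 0 ≤ x) : phi x ≤ 1 :=
  phi_zero ▸ phi_strictAntiOn.antitoneOn Set.self_mem_Ici hx hx

lemma continuousOn_phi : ContinuousOn phi (Set.Ici 0) := by
  have h : Continuous fun x : ℝ => Real.exp (-x / 4) * sechMean x :=
    Continuous.mul (by fun_prop) continuous_sechMean
  exact h.continuousOn.congr fun x hx => phi_eq_exp_mul_sechMean hx

lemma exists_phi_eq {y : ℝ} (hy : 0 < y) (hy1 : y ≤ 1) : ∃ x ∈ Set.Ici (0 : ℝ), phi x = y := by
  -- The right endpoint for the intermediate value theorem solves `exp (-x / 4) = y`.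
  have hX : 0 ≤ -4 * Real.log y := by nlinarith [Real.log_nonpos hy.le hy1]
  have hle : phi (-4 * Real.log y) ≤ y := by
    have h := phi_le_exp_mul_phi le_rfl hX
    have h4 : -(-4 * Real.log y - 0) / 4 = Real.log y := by ring
    rwa [h4, Real.exp_log hy, phi_zero, mul_one] at h
  obtain ⟨x, hx, hxy⟩ := intermediate_value_Icc' hX
    (continuousOn_phi.mono Set.Icc_subset_Ici_self) ⟨hle, phi_zero.symm ▸ hy1⟩
  exact ⟨x, hx.1, hxy⟩

/-! ### Check nodes and the recursion -/

lemma exists_phi_eq_check {j : ℕ} (hj : 2 ≤ j) {x : ℝ} (hx : 0 ≤ x) :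
    ∃ z ∈ Set.Ici (0 : ℝ), phi z = 1 - (1 - phi x) ^ (j - 1) := by
  have h0 := phi_pos hx
  have h1 := phi_le_one hx
  refine exists_phi_eq ?_ ?_
  · have := pow_lt_one₀ (sub_nonneg.2 h1) (by linarith) (show j - 1 ≠ 0 by omega)
    linarith
  · have := pow_nonneg (sub_nonneg.2 h1) (j - 1)
    linarith

lemma checkOut_nonneg {j : ℕ} (hj : 2 ≤ j) {x : ℝ} (hx : 0 ≤ x) : 0 ≤ checkOut j x :=
  Function.invFunOn_mem (exists_phi_eq_check hj hx)

lemma phi_checkOut {j : ℕ} (hj : 2 ≤ j) {x : ℝ} (hx : 0 ≤ x) :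
    phi (checkOut j x) = 1 - (1 - phi x) ^ (j - 1) :=
  Function.invFunOn_eq (exists_phi_eq_check hj hx)

lemma checkOut_mono {j : ℕ} (hj : 2 ≤ j) {x y : ℝ} (hx : 0 ≤ x) (hxy : x ≤ y) :
    checkOut j x ≤ checkOut j y := by
  have hy := hx.trans hxy
  rw [← phi_strictAntiOn.le_iff_ge (checkOut_nonneg hj hy) (checkOut_nonneg hj hx),
    phi_checkOut hj hx, phi_checkOut hj hy]
  have h : phi y ≤ phi x := phi_strictAntiOn.antitoneOn hx hy hxy
  have := pow_le_pow_left₀ (sub_nonneg.2 (phi_le_one hx)) (sub_le_sub_left h 1) (j - 1)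
  linarith

/-- A check node of degree `j` lowers the mean by at most the constant `4 log (j - 1)`. -/
lemma sub_log_le_checkOut {j : ℕ} (hj : 2 ≤ j) {x : ℝ} (hx : 0 ≤ x) :
    x - 4 * Real.log ((j - 1 : ℕ) : ℝ) ≤ checkOut j x := by
  have hj1 : (1 : ℝ) ≤ ((j - 1 : ℕ) : ℝ) := by
    exact_mod_cast (show 1 ≤ j - 1 by omega)
  rcases le_total x (checkOut j x) with hz | hz
  · linarith [Real.log_nonneg hj1]
  have hbern : phi (checkOut j x) ≤ ((j - 1 : ℕ) : ℝ) * phi x := by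
    rw [phi_checkOut hj hx]
    have := one_add_mul_le_pow (a := -phi x) (by linarith [phi_le_one hx]) (j - 1)
    rw [← sub_eq_add_neg] at this
    linarith
  have h := (phi_le_exp_mul_phi (checkOut_nonneg hj hx) hz).trans
    (mul_le_mul_of_nonneg_left hbern (Real.exp_pos _).le)
  rw [← mul_assoc] at h
  -- Cancelling `phi x` leaves `1 ≤ exp (-(x - z) / 4) * (j - 1)` with `z = checkOut j x`.
  have h1 := (le_mul_iff_one_le_left (phi_pos hx)).1 h
  have h2 := Real.log_nonneg h1
  rw [Real.log_mul (Real.exp_pos _).ne' (by linarith), Real.log_exp] at h2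
  linarith

section Recursion

variable {dv dr : ℕ} {ρ : ℕ → ℝ}

lemma checkMean_nonneg (hdv : 1 ≤ dv) (hρ : ∀ j ∈ Finset.Icc 2 dr, 0 ≤ ρ j) {a : ℝ} (ha : 0 ≤ a)
    (l : ℕ) : 0 ≤ checkMean dv dr ρ a l := by
  induction l with
  | zero => exact le_rfl
  | succ l ih =>
    have hd : (0 : ℝ) ≤ (dv : ℝ) - 1 := sub_nonneg.2 (by exact_mod_cast hdv)
    exact Finset.sum_nonneg fun j hj => mul_nonneg (hρ j hj)
      (checkOut_nonneg (Finset.mem_Icc.1 hj).1 (by positivity))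

lemma checkMean_mono (hdv : 1 ≤ dv) (hρ : ∀ j ∈ Finset.Icc 2 dr, 0 ≤ ρ j) {a b : ℝ} (ha : 0 ≤ a)
    (hab : a ≤ b) (l : ℕ) : checkMean dv dr ρ a l ≤ checkMean dv dr ρ b l := by
  induction l with
  | zero => exact le_rfl
  | succ l ih =>
    have hd : (0 : ℝ) ≤ (dv : ℝ) - 1 := sub_nonneg.2 (by exact_mod_cast hdv)
    have hm := checkMean_nonneg hdv hρ ha l
    exact Finset.sum_le_sum fun j hj => mul_le_mul_of_nonneg_left
      (checkOut_mono (Finset.mem_Icc.1 hj).1 (by positivity)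
        (add_le_add hab (mul_le_mul_of_nonneg_left ih hd))) (hρ j hj)

/-- The mean loss of a check node, averaged over the degree distribution. -/
noncomputable def checkLoss (dr : ℕ) (ρ : ℕ → ℝ) : ℝ :=
  ∑ j ∈ Finset.Icc 2 dr, ρ j * (4 * Real.log ((j - 1 : ℕ) : ℝ))

lemma mul_sub_checkLoss_le_checkMean_succ (hdv : 1 ≤ dv) (hρ : ∀ j ∈ Finset.Icc 2 dr, 0 ≤ ρ j)
    (hsum : ∑ j ∈ Finset.Icc 2 dr, ρ j = 1) {a : ℝ} (ha : 0 ≤ a) (l : ℕ) :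
    ((dv : ℝ) - 1) * checkMean dv dr ρ a l - checkLoss dr ρ ≤ checkMean dv dr ρ a (l + 1) := by
  have hd : (0 : ℝ) ≤ (dv : ℝ) - 1 := sub_nonneg.2 (by exact_mod_cast hdv)
  have hm := checkMean_nonneg hdv hρ ha l
  have hx : 0 ≤ a + ((dv : ℝ) - 1) * checkMean dv dr ρ a l := by positivity
  -- The channel mean `a ≥ 0` is discarded here.
  calc ((dv : ℝ) - 1) * checkMean dv dr ρ a l - checkLoss dr ρ
      ≤ (∑ j ∈ Finset.Icc 2 dr, ρ j) * (a + ((dv : ℝ) - 1) * checkMean dv dr ρ a l)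
          - checkLoss dr ρ := by rw [hsum]; linarith
    _ = ∑ j ∈ Finset.Icc 2 dr, ρ j * (a + ((dv : ℝ) - 1) * checkMean dv dr ρ a l
          - 4 * Real.log ((j - 1 : ℕ) : ℝ)) := by
        simp only [checkLoss, Finset.sum_mul, mul_sub, Finset.sum_sub_distrib]
    _ ≤ checkMean dv dr ρ a (l + 1) := Finset.sum_le_sum fun j hj =>
        mul_le_mul_of_nonneg_left (sub_log_le_checkOut (Finset.mem_Icc.1 hj).1 hx) (hρ j hj)

end Recursion

/-! ### Growth and error probability -/

/-- A sequence with `d * m l - K ≤ m (l + 1)` that once exceeds the fixed point `K / (d - 1)`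
grows faster than every `r ^ l` with `r < d`. -/
lemma exists_forall_mul_pow_lt {m : ℕ → ℝ} {d K r : ℝ} (hd : 1 < d) (hr : 0 ≤ r) (hrd : r < d)
    (hm : ∀ l, d * m l - K ≤ m (l + 1)) (hK : 0 ≤ K) {n : ℕ} (hn : K / (d - 1) < m n) (C : ℝ) :
    ∃ L : ℕ, ∀ l : ℕ, L ≤ l → C * r ^ l < m l := by
  set F := K / (d - 1) with hF
  have hFK : F * (d - 1) = K := div_mul_cancel₀ _ (by linarith)
  have hF0 : 0 ≤ F := div_nonneg hK (by linarith)
  have hd0 : 0 < d := by linarith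
  -- As `d * F - K = F`, the excess over `F` gains a factor `d` at each step.
  have hgrow : ∀ k, d ^ k * (m n - F) ≤ m (n + k) - F := by
    intro k
    induction k with
    | zero => simp
    | succ k ih =>
      have h1 := hm (n + k)
      have h2 := mul_le_mul_of_nonneg_left ih hd0.le
      rw [← add_assoc, pow_succ]
      linarith
  have hc : 0 < (m n - F) / d ^ n := div_pos (sub_pos.2 hn) (pow_pos hd0 n)
  have hlim : Tendsto (fun l : ℕ => C * (r / d) ^ l) atTop (𝓝 0) := by
    simpa using (tendsto_pow_atTop_nhds_zero_of_lt_one (div_nonneg hr hd0.le)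
      ((div_lt_one hd0).2 hrd)).const_mul C
  obtain ⟨L, hL⟩ := eventually_atTop.1 (hlim.eventually (gt_mem_nhds hc))
  refine ⟨max L n, fun l hl => ?_⟩
  have h1 := hL l ((le_max_left _ _).trans hl)
  obtain ⟨k, rfl⟩ := Nat.exists_eq_add_of_le ((le_max_right _ _).trans hl)
  have h2 := hgrow k
  rw [div_pow, ← mul_div_assoc, div_lt_iff₀ (pow_pos hd0 _), pow_add d, ← mul_assoc,
    div_mul_cancel₀ _ (pow_pos hd0 n).ne'] at h1
  linarith

/-- The consistent Gaussian `N(μ, 2 μ)` gives the non-positive half line a mass that is bounded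
below in terms of an upper bound for `μ`. -/
lemma gaussianReal_Iic_zero_ge {μ B : ℝ} (hμ : 0 < μ) (hB : μ ≤ B) :
    (ProbabilityTheory.gaussianReal 0 1).real (Set.Iic (-√(B / 2))) ≤
      (ProbabilityTheory.gaussianReal μ (2 * μ).toNNReal).real (Set.Iic 0) := by
  have hmap : (ProbabilityTheory.gaussianReal 0 1).map (fun z => √(2 * μ) * z + μ) =
      ProbabilityTheory.gaussianReal μ (2 * μ).toNNReal := by
    have hcomp : (fun z : ℝ => √(2 * μ) * z + μ) = (fun z => z + μ) ∘ fun z => √(2 * μ) * z := rfl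
    rw [hcomp, ← Measure.map_map (by fun_prop) (by fun_prop),
      ProbabilityTheory.gaussianReal_map_const_mul, ProbabilityTheory.gaussianReal_map_add_const]
    congr 1
    · ring
    · rw [mul_one]
      ext
      simp [mul_pow, hμ.le]
  rw [← hmap, map_measureReal_apply (by fun_prop) measurableSet_Iic]
  refine measureReal_mono fun z hz => ?_
  simp only [Set.mem_Iic, Set.mem_preimage] at hz ⊢
  have h1 : √(μ / 2) ≤ √(B / 2) := Real.sqrt_le_sqrt (by linarith)
  have h2 : √(2 * μ) * √(μ / 2) = μ := by
    rw [← Real.sqrt_mul (by linarith), show 2 * μ * (μ / 2) = μ ^ 2 by ring, Real.sqrt_sq hμ.le]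
  have h3 := mul_le_mul_of_nonneg_left (show z ≤ -√(μ / 2) by linarith) (Real.sqrt_nonneg (2 * μ))
  linarith

lemma gaussianReal_Iic_pos (c : ℝ) :
    0 < (ProbabilityTheory.gaussianReal 0 1).real (Set.Iic c) := by
  rw [measureReal_def, ENNReal.toReal_pos_iff]
  refine ⟨pos_iff_ne_zero.2 fun h => ?_, measure_lt_top _ _⟩
  -- A Gaussian-null half line would be Lebesgue-null.
  have := ProbabilityTheory.gaussianReal_absolutelyContinuous' 0 one_ne_zero h
  simp at this

/-- If the bit error probability tends to `0`, the check node means exceed every bound. -/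
lemma exists_lt_checkMean_of_tendsto {dv dr : ℕ} {ρ : ℕ → ℝ} (hdv : 1 ≤ dv)
    (hρ : ∀ j ∈ Finset.Icc 2 dr, 0 ≤ ρ j) {a : ℝ} (ha : 0 < a)
    (h : Tendsto (fun l : ℕ => bitErrorProb dv dr ρ a l) atTop (𝓝 0)) (M : ℝ) :
    ∃ n, M < checkMean dv dr ρ a n := by
  -- Bounded means would keep the error probability above a fixed positive Gaussian tail.
  by_contra! hle
  obtain ⟨l, hl⟩ := (h.eventually
    (gt_mem_nhds (gaussianReal_Iic_pos (-√((a + dv * M) / 2))))).exists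
  have hm := checkMean_nonneg hdv hρ ha.le l
  refine absurd hl (not_lt.2 (gaussianReal_Iic_zero_ge ?_ ?_))
  · exact add_pos_of_pos_of_nonneg ha (by positivity)
  · exact add_le_add le_rfl (mul_le_mul_of_nonneg_left (hle l) (Nat.cast_nonneg dv))

end DensityEvolution

theorem mainTheorem8 (dv dr : ℕ) (hdv : 3 ≤ dv)
    (ρ : ℕ → ℝ) (hρ_nonneg : ∀ j ∈ Finset.Icc 2 dr, 0 ≤ ρ j)
    (hρ_sum : ∑ j ∈ Finset.Icc 2 dr, ρ j = 1)
    (R : ℝ) (hR_pos : 0 < R) (hR_le : R ≤ 1)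
    (snr : ℝ) (hsnr : DensityEvolution.decodingThreshold dv dr ρ R < (snr : EReal))
    (r : ℝ) (hr_one : 1 ≤ r) (hr_lt : r < (dv : ℝ) - 1) (C : ℝ) :
    ∃ L : ℕ, ∀ l : ℕ, L ≤ l →
      C * r ^ l < DensityEvolution.checkMean dv dr ρ (DensityEvolution.channelMean R snr) l := by
  -- Convergence is known only at some `e < snr`, not at `snr` itself.
  open DensityEvolution in
  obtain ⟨_, ⟨e, ⟨he, hlim⟩, rfl⟩, hlt⟩ := sInf_lt_iff.1 hsnr
  have hes : e < snr := EReal.coe_lt_coe_iff.1 hlt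
  have ha : 0 < channelMean R e := by unfold channelMean; positivity
  have hab : channelMean R e ≤ channelMean R snr :=
    mul_le_mul_of_nonneg_left hes.le (by positivity)
  have hdv1 : 1 ≤ dv := by omega
  have hK : 0 ≤ checkLoss dr ρ := Finset.sum_nonneg fun j hj =>
    mul_nonneg (hρ_nonneg j hj) (mul_nonneg (by norm_num) (Real.log_natCast_nonneg _))
  obtain ⟨n, hn⟩ := exists_lt_checkMean_of_tendsto hdv1 hρ_nonneg ha hlim
    (checkLoss dr ρ / ((dv : ℝ) - 1 - 1))
  exact exists_forall_mul_pow_lt (by linarith) (by linarith) hr_lt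
    (mul_sub_checkLoss_le_checkMean_succ hdv1 hρ_nonneg hρ_sum (ha.le.trans hab)) hK
    (hn.trans_le (checkMean_mono hdv1 hρ_nonneg ha.le hab n)) C
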